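/- For finite simple graphs $G$ and $H$ and an integer $s\ge 1$, write $H\xrightarrow{s}G$ if every colouring of the edges of $H$ with $s$ colours contains a monochromatic copy of $G$ as a (not necessarily induced) subgraph. Let $$br_\Delta(G;s)=\min\{\Delta(H): H \text{ is a finite bipartite graph and } H\xrightarrow{s}G\},$$ where $\Delta(H)$ is the maximum degree of $H$. **Theorem.** Let $k\ge 1$ and $s\ge 1$ be integers, and let $T$ be a finite tree in which one vertex has degree $k$ and all other vertices have degree at most $\lceil k/2\rceil$. Then the set in the definition of $br_\Delta(T;s)$ is nonempty and $$br_\Delta(T;s)=s(k-1)+1.$$ -/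

import Mathlib

/-- `RamseyArrow H G s`: every colouring of the edges of `H` with `s` colours contains a
monochromatic copy of `G` (as a not necessarily induced subgraph). -/
def RamseyArrow {W V : Type*} (H : SimpleGraph W) (G : SimpleGraph V) (s : ℕ) : Prop :=
  ∀ c : H.EdgeLabeling (Fin s), ∃ i : Fin s, G.IsContained (c.labelGraph i)

open Classical in
/-- The maximum degrees of the finite bipartite graphs `H` such that every `s`-colouring of the
edges of `H` contains a monochromatic copy of `G`. Every finite graph is isomorphic to one
on some `Fin n`. -/
def bipartiteRamseyDegrees {V : Type*} (G : SimpleGraph V) (s : ℕ) : Set ℕ :=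
  {d | ∃ (n : ℕ) (H : SimpleGraph (Fin n)),
    H.IsBipartite ∧ RamseyArrow H G s ∧ H.maxDegree = d}

/-- The degree bipartite Ramsey number: the smallest maximum degree of a finite bipartite
graph `H` such that every `s`-colouring of the edges of `H` contains a monochromatic `G`. -/
noncomputable def degreeBipartiteRamsey {V : Type*} (G : SimpleGraph V) (s : ℕ) : ℕ :=
  sInf (bipartiteRamseyDegrees G s)

/-! Lower bound: by König's edge-colouring theorem, a bipartite graph of maximum degree at most `s *
(k - 1)` splits into `s * (k - 1)` matchings. Merging them in groups of `k - 1` gives `s` colour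
classes with no vertex of degree `k` (`RamseyArrow.lt_maxDegree`).

Upper bound: take a bipartite graph, regular of degree `s * (k - 1) + 1`, of girth larger than `T`.
Some colour class has average degree above `k - 1`; deleting vertices of low degree leaves a
subgraph of minimum degree above `(k - 1) / 2` with a vertex of degree at least `k`. There `T` maps
greedily and locally injectively, and the girth makes the map injective
(`ramseyArrow_of_no_short_closed_walk`). -/

/-! ### Splitting bipartite graphs into matchings -/

/-- A square matrix of natural numbers with constant positive line sums has a permutation
in its support. -/
theorem exists_perm_pos_of_line_sums {n : Type*} [Fintype n] [DecidableEq n] (M : n → n → ℕ)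
    {D : ℕ} (hD : 0 < D) (hr : ∀ i, ∑ j, M i j = D) (hc : ∀ j, ∑ i, M i j = D) :
    ∃ σ : Equiv.Perm n, ∀ i, 0 < M i (σ i) := by
  let f (i : n) : Finset n := {j | M i j ≠ 0}
  -- Hall's condition: the rows in `A` have total mass `A.card * D`, all inside the columns
  -- `A.biUnion f`, which hold only `D` each.
  have hf (A : Finset n) : A.card ≤ (A.biUnion f).card := by
    have h₁ : ∑ i ∈ A, ∑ j ∈ f i, M i j = A.card * D := by
      simp [f, Finset.sum_filter_ne_zero, hr]
    have h₂ : ∑ i, ∑ j ∈ A.biUnion f, M i j = (A.biUnion f).card * D := by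
      rw [Finset.sum_comm]
      simp [hc]
    refine le_of_mul_le_mul_right ?_ hD
    rw [← h₁, ← h₂]
    trans ∑ i ∈ A, ∑ j ∈ A.biUnion f, M i j
    · exact Finset.sum_le_sum fun i hi =>
        Finset.sum_le_sum_of_subset (Finset.subset_biUnion_of_mem f hi)
    · exact Finset.sum_le_sum_of_subset (Finset.subset_univ _)
  obtain ⟨g, hg, hg'⟩ := (Finset.all_card_le_biUnion_card_iff_exists_injective f).1 hf
  rw [Finite.injective_iff_bijective] at hg
  refine ⟨Equiv.ofBijective g hg, fun i => ?_⟩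
  simpa [f, Nat.pos_iff_ne_zero] using hg' i

/-- The support of a square matrix of natural numbers with line sums `D` is covered by
`D` permutations. -/
theorem exists_perms_cover_of_line_sums {n : Type*} [Fintype n] [DecidableEq n] (D : ℕ) :
    ∀ M : n → n → ℕ, (∀ i, ∑ j, M i j = D) → (∀ j, ∑ i, M i j = D) →
      ∃ σ : Fin D → Equiv.Perm n, ∀ i j, 0 < M i j → ∃ c, σ c i = j := by
  induction D with
  | zero =>
    intro M hr _
    refine ⟨Fin.elim0, fun i j hij => ?_⟩
    have := (Finset.sum_eq_zero_iff.1 (hr i)) j (Finset.mem_univ _)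
    omega
  | succ D ih =>
    intro M hr hc
    obtain ⟨τ, hτ⟩ := exists_perm_pos_of_line_sums M D.succ_pos hr hc
    let P (i j : n) : ℕ := if τ i = j then 1 else 0
    -- Truncated subtraction is exact because `τ` lies in the support of `M`.
    have hP : ∀ i j, M i j - P i j + P i j = M i j := by
      intro i j
      refine Nat.sub_add_cancel ?_
      by_cases h : τ i = j
      · subst h; simpa [P] using Nat.succ_le_of_lt (hτ i)
      · simp [P, h]
    have hPr : ∀ i, ∑ j, P i j = 1 := fun i => by simp [P]
    have hPc : ∀ j, ∑ i, P i j = 1 := fun j => by simp [P, ← Equiv.eq_symm_apply]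
    obtain ⟨σ, hσ⟩ := ih (fun i j => M i j - P i j)
      (fun i => by
        have : ∑ j, (M i j - P i j) + ∑ j, P i j = D + 1 := by
          rw [← Finset.sum_add_distrib, ← hr i]; simp [hP]
        rw [hPr] at this; omega)
      (fun j => by
        have : ∑ i, (M i j - P i j) + ∑ i, P i j = D + 1 := by
          rw [← Finset.sum_add_distrib, ← hc j]; simp [hP]
        rw [hPc] at this; omega)
    refine ⟨Fin.cons τ σ, fun i j hij => ?_⟩
    by_cases h : τ i = j
    · exact ⟨0, by simpa using h⟩
    · obtain ⟨c, hc⟩ := hσ i j (by simpa [P, h] using hij)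
      exact ⟨c.succ, by simpa using hc⟩

open Classical in
/-- In a graph of maximum degree at most `D`, the edges directed out of `A` are covered by `D`
permutations, from a first to a second copy of the vertex set. -/
theorem SimpleGraph.exists_perms_cover {W : Type*} [Fintype W]
    (H : SimpleGraph W) (A : Set W) {D : ℕ} (hd : ∀ x, H.degree x ≤ D) :
    ∃ σ : Fin D → Equiv.Perm (W ⊕ W), ∀ x y, x ∈ A → H.Adj x y →
      ∃ c, σ c (Sum.inl x) = Sum.inl y := by
  let b (x y : W) : ℕ := if x ∈ A ∧ H.Adj x y then 1 else 0
  have hr : ∀ x, ∑ y, b x y ≤ D := fun x => by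
    refine le_trans ?_ (hd x)
    rw [← H.card_neighborFinset_eq_degree, H.neighborFinset_eq_filter, Finset.card_filter]
    exact Finset.sum_le_sum fun y _ => by by_cases h : H.Adj x y <;> simp [b, h]; split <;> simp
  have hc : ∀ y, ∑ x, b x y ≤ D := fun y => by
    refine le_trans ?_ (hd y)
    rw [← H.card_neighborFinset_eq_degree, H.neighborFinset_eq_filter, Finset.card_filter]
    exact Finset.sum_le_sum fun x _ => by
      by_cases h : H.Adj x y <;> simp [b, h, H.adj_comm y x]; split <;> simp
  -- The transpose of `b` and two diagonal blocks of deficits pad every line sum to `D`.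
  let M : W ⊕ W → W ⊕ W → ℕ := fun p q => match p, q with
    | .inl x, .inl y => b x y
    | .inl x, .inr y => if x = y then D - ∑ z, b x z else 0
    | .inr x, .inl y => if x = y then D - ∑ z, b z x else 0
    | .inr x, .inr y => b y x
  obtain ⟨σ, hσ⟩ := exists_perms_cover_of_line_sums D M
    (by
      rintro (x | x)
      · have := hr x
        simp [M, Fintype.sum_sum_type]; omega
      · have := hc x
        simp [M, Fintype.sum_sum_type]; omega)
    (by
      rintro (x | x)
      · have := hc x
        simp [M, Fintype.sum_sum_type]; omega
      · have := hr x
        simp [M, Fintype.sum_sum_type]; omega)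
  exact ⟨σ, fun x y hx hxy => hσ _ _ (by simp [M, b, hx, hxy])⟩

open Classical in
/-- A bipartite graph of maximum degree at most `s * m` splits into `s` graphs of maximum degree
at most `m`. -/
theorem SimpleGraph.IsBipartite.exists_edgeLabeling_degree_le {W : Type*} [Fintype W]
    {H : SimpleGraph W} (hH : H.IsBipartite) {s m : ℕ} (hd : ∀ x, H.degree x ≤ s * m) :
    ∃ c : H.EdgeLabeling (Fin s), ∀ i x, (c.labelGraph i).degree x ≤ m := by
  obtain ⟨A, B, hAB⟩ := hH.exists_isBipartiteWith
  obtain ⟨σ, hσ⟩ := H.exists_perms_cover A hd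
  have key : ∀ e : H.edgeSet, ∃ c : Fin (s * m), ∃ x y, x ∈ A ∧ y ∉ A ∧ e.1 = s(x, y) ∧
      σ c (Sum.inl x) = Sum.inl y := by
    rintro ⟨e, he⟩
    induction e using Sym2.inductionOn with
    | hf x y =>
      have hxy : H.Adj x y := he
      rcases hAB.mem_of_adj hxy with ⟨hx, hy⟩ | ⟨hx, hy⟩
      · obtain ⟨c, hc⟩ := hσ x y hx hxy
        exact ⟨c, x, y, hx, Set.disjoint_right.1 hAB.disjoint hy, rfl, hc⟩
      · obtain ⟨c, hc⟩ := hσ y x hy hxy.symm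
        exact ⟨c, y, x, hy, Set.disjoint_right.1 hAB.disjoint hx, Sym2.eq_swap, hc⟩
  choose col hcol using key
  -- Each colour is a matching: at `x ∈ A` because `σ c` is a function, at `x ∉ A` because it is
  -- injective.
  have hinj : ∀ x y z (hy : H.Adj x y) (hz : H.Adj x z),
      col ⟨s(x, y), hy⟩ = col ⟨s(x, z), hz⟩ → y = z := by
    intro x y z hy hz h
    obtain ⟨p, q, hp, hq, hpq, h₁⟩ := hcol ⟨s(x, y), hy⟩
    obtain ⟨p', q', hp', hq', hpq', h₂⟩ := hcol ⟨s(x, z), hz⟩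
    rw [h] at h₁
    rcases Sym2.eq_iff.1 hpq with ⟨rfl, rfl⟩ | ⟨rfl, rfl⟩ <;>
      rcases Sym2.eq_iff.1 hpq' with ⟨rfl, rfl⟩ | ⟨rfl, rfl⟩
    · exact Sum.inl_injective (h₁.symm.trans h₂)
    · exact absurd hp hq'
    · exact absurd hp' hq
    · exact Sum.inl_injective ((Equiv.injective _) (h₁.trans h₂.symm))
  -- The `s * m` matchings fall into `s` groups of `m`.
  let c : H.EdgeLabeling (Fin s) := fun e => (finProdFinEquiv.symm (col e)).1
  refine ⟨c, fun i x => ?_⟩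
  have hadj : ∀ y : (c.labelGraph i).neighborSet x, H.Adj x y := fun y => c.labelGraph_le y.2
  rw [← SimpleGraph.card_neighborSet_eq_degree]
  refine (Fintype.card_le_of_injective
    (fun y : (c.labelGraph i).neighborSet x =>
      (finProdFinEquiv.symm (col ⟨s(x, y), hadj y⟩)).2) fun y z hyz => ?_).trans_eq
    (Fintype.card_fin m)
  obtain ⟨_, hy⟩ := (SimpleGraph.EdgeLabeling.labelGraph_adj x y.1).1 y.2
  obtain ⟨_, hz⟩ := (SimpleGraph.EdgeLabeling.labelGraph_adj x z.1).1 z.2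
  exact Subtype.ext (hinj x y z (hadj y) (hadj z)
    (finProdFinEquiv.symm.injective (Prod.ext (hy.trans hz.symm) hyz)))

/-! ### Regular bipartite graphs of large girth -/

/-- Cancel the letter `i` at the front of a word, or else prepend it if the length allows. -/
def toggleHead {α : Type*} [DecidableEq α] (r : ℕ) (i : α) : List α → List α
  | [] => if 0 < r then [i] else []
  | j :: t => if j = i then t else if t.length + 1 < r then i :: j :: t else j :: t

theorem toggleHead_length_le {α : Type*} [DecidableEq α] {r : ℕ} (i : α) {l : List α}
    (hl : l.length ≤ r) : (toggleHead r i l).length ≤ r := by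
  cases l <;> grind [toggleHead]

theorem isChain_toggleHead {α : Type*} [DecidableEq α] (r : ℕ) (i : α) {l : List α}
    (hc : l.IsChain (· ≠ ·)) : (toggleHead r i l).IsChain (· ≠ ·) := by
  cases l <;> grind [toggleHead, List.isChain_cons]

/-- After `i` is cancelled, the rest of a reduced word does not begin with `i` and is shorter than
`r`, so the next toggle restores `i`. -/
theorem toggleHead_toggleHead {α : Type*} [DecidableEq α] {r : ℕ} (i : α) {l : List α}
    (hl : l.length ≤ r) (hc : l.IsChain (· ≠ ·)) :
    toggleHead r i (toggleHead r i l) = l := by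
  rcases l with _ | ⟨j, _ | ⟨k, t⟩⟩ <;> grind [toggleHead, List.isChain_cons]

theorem toggleHead_eq_cons {α : Type*} [DecidableEq α] {r : ℕ} {i : α} {l : List α}
    (hl : l.length < r) (hc : (i :: l).IsChain (· ≠ ·)) : toggleHead r i l = i :: l := by
  cases l <;> grind [toggleHead, List.isChain_cons]

/-- The words of length at most `r` without equal consecutive letters. -/
abbrev ReducedWord (α : Type*) (r : ℕ) : Type _ :=
  {l : List α // l.length ≤ r ∧ l.IsChain (· ≠ ·)}

instance (α : Type*) [Finite α] (r : ℕ) : Finite (ReducedWord α r) :=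
  ((List.finite_length_le α r).subset fun _ h => h.1).to_subtype

/-- The involution of the reduced words that toggles the letter `i` at the front. -/
def toggleHeadPerm {α : Type*} [DecidableEq α] (r : ℕ) (i : α) :
    Equiv.Perm (ReducedWord α r) :=
  Function.Involutive.toPerm
    (fun l => ⟨toggleHead r i l.1, toggleHead_length_le i l.2.1, isChain_toggleHead r i l.2.2⟩)
    fun l => Subtype.ext (toggleHead_toggleHead i l.2.1 l.2.2)

/-- The rightmost letter acts first and each later one is prepended. Hence no nonempty reduced word
of length at most `r` acts trivially. -/
theorem prod_toggleHeadPerm_apply_nil {α : Type*} [DecidableEq α] {r : ℕ} (l : List α)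
    (hl : l.length ≤ r) (hc : l.IsChain (· ≠ ·)) :
    ((l.map (toggleHeadPerm r)).prod ⟨[], r.zero_le, List.isChain_nil⟩).1 = l := by
  induction l with
  | nil => rfl
  | cons i t ih =>
    have ht := ih (by simp at hl; omega) (List.isChain_cons.1 hc).2
    rw [List.map_cons, List.prod_cons, Equiv.Perm.mul_apply]
    refine (congrArg (toggleHead r i) ht).trans (toggleHead_eq_cons ?_ hc)
    simpa using hl

/-- There is a finite group with a sign character and `d` odd involutions that satisfy no
nontrivial relation of length at most `r`. -/
theorem exists_finite_group_involutions (d r : ℕ) :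
    ∃ (G : Type) (_ : Group G) (_ : Fintype G) (a : Fin d → G) (χ : G →* ℤˣ),
      (∀ i, a i * a i = 1) ∧ (∀ i, χ (a i) = -1) ∧
      ∀ l : List (Fin d), l.IsChain (· ≠ ·) → l.length ≤ r → (l.map a).prod = 1 → l = [] := by
  classical
  -- The factor `ℤˣ` makes every generator odd, whatever the sign of its permutation.
  refine ⟨Equiv.Perm (ReducedWord (Fin d) r) × ℤˣ, inferInstance, Fintype.ofFinite _,
    fun i => (toggleHeadPerm r i, -1), MonoidHom.snd _ _, fun i => ?_, fun i => rfl, ?_⟩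
  · refine Prod.ext (Equiv.ext fun l => ?_) (by simp)
    exact Subtype.ext (toggleHead_toggleHead i l.2.1 l.2.2)
  · intro l hc hl h
    have h₁ := congrArg (MonoidHom.fst _ _) h
    rw [map_list_prod, List.map_map] at h₁
    have h₂ := prod_toggleHeadPerm_apply_nil l hl hc
    have h₃ : (l.map (toggleHeadPerm r)).prod = 1 := h₁
    rw [h₃] at h₂
    exact h₂.symm

open Classical in
/-- For `r ≥ 2` there is a finite `d`-regular bipartite graph in which no closed walk of positive
length at most `r` is free of backtracking. -/
theorem exists_regular_bipartite_no_short_closed_walk (d : ℕ) {r : ℕ} (hr : 2 ≤ r) :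
    ∃ (n : ℕ) (H : SimpleGraph (Fin n)), 0 < n ∧ H.IsBipartite ∧ (∀ x, H.degree x = d) ∧
      ∀ x y (p : H.Walk x y), p.edges.IsChain (· ≠ ·) → p.length ≤ r → x = y →
        p.length = 0 := by
  obtain ⟨G, _, _, a, χ, haa, hχ, hrel⟩ := exists_finite_group_involutions d r
  let e : Fin (Fintype.card G) ≃ G := (Fintype.equivFin G).symm
  have ha : Function.Injective a := fun i j hij => by
    by_contra hne
    simpa using hrel [i, j] (by simpa using hne) (by simpa using hr) (by simp [hij, haa])
  have hback : ∀ g i, g * a i * a i = g := fun g i => by rw [mul_assoc, haa, mul_one]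
  have hχne : ∀ g i, χ (g * a i) ≠ χ g := fun g i => by
    rw [map_mul, hχ]
    rcases Int.units_eq_one_or (χ g) with h | h <;> rw [h] <;> decide
  -- The Cayley graph of `G` for the involutions `a i`; `χ` is its bipartition.
  let H : SimpleGraph (Fin (Fintype.card G)) :=
    { Adj := fun x y => ∃ i, e x * a i = e y
      symm := ⟨fun x y ⟨i, h⟩ => ⟨i, by rw [← h, hback]⟩⟩
      loopless := ⟨fun x ⟨i, h⟩ => hχne (e x) i (by rw [h])⟩ }
  refine ⟨_, H, Fintype.card_pos, ?_, fun x => ?_, ?_⟩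
  · have C : H.Coloring ℤˣ := SimpleGraph.Coloring.mk (fun x => χ (e x)) (by
      rintro x y ⟨i, h⟩ hxy
      exact hχne (e x) i (by rw [h]; exact hxy.symm))
    simpa using C.colorable
  · rw [← H.card_neighborFinset_eq_degree]
    trans (Finset.univ.image fun i => e.symm (e x * a i)).card
    · congr 1
      ext y
      simp [H, Equiv.symm_apply_eq]
    rw [Finset.card_image_of_injective]
    · simp
    · exact e.symm.injective.comp ((mul_right_injective _).comp ha)
  -- A walk spells a word in the generators. The clause on the first edge carries the induction: a
  -- repeated letter would traverse the same edge back.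
  · have key : ∀ x y (p : H.Walk x y), p.edges.IsChain (· ≠ ·) →
        ∃ l : List (Fin d), l.IsChain (· ≠ ·) ∧ l.length = p.length ∧
          e x * (l.map a).prod = e y ∧
          ∀ i ∈ l.head?, s(x, e.symm (e x * a i)) ∈ p.edges.head? := by
      intro x y p
      induction p with
      | nil => exact fun _ => ⟨[], by simp⟩
      | @cons x z y h q ih =>
        intro hc
        rw [SimpleGraph.Walk.edges_cons, List.isChain_cons] at hc
        obtain ⟨l, hl, hlen, hprod, hhead⟩ := ih hc.2
        obtain ⟨i, hi⟩ := h
        refine ⟨i :: l, List.isChain_cons.2 ⟨fun j hj hij => ?_, hl⟩, by simp [hlen], ?_, ?_⟩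
        · subst hij
          refine hc.1 _ (hhead i hj) ?_
          rw [← hi, hback, Equiv.symm_apply_apply, Sym2.eq_swap]
        · rw [List.map_cons, List.prod_cons, ← mul_assoc, hi, hprod]
        · simp [hi]
    rintro x y p hc hlen rfl
    obtain ⟨l, hl, hlen', hprod, -⟩ := key _ _ p hc
    rw [← hlen', hrel l hl (hlen' ▸ hlen) (by simpa using hprod), List.length_nil]

/-! ### Embedding trees greedily -/

/-- In a tree, the neighbour of a vertex that is closer to a given root is unique. -/
theorem SimpleGraph.IsTree.eq_of_adj_of_dist_lt {V : Type*} {T : SimpleGraph V} (hT : T.IsTree)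
    {v u u' w : V} (h : T.Adj u w) (h' : T.Adj u' w) (hd : T.dist v u < T.dist v w)
    (hd' : T.dist v u' < T.dist v w) : u = u' := by
  have key : ∀ z (hz : T.Adj z w), T.dist v z < T.dist v w →
      ∃ p : T.Walk v w, p.IsPath ∧ p.penultimate = z := by
    intro z hz hlt
    obtain ⟨q, hq⟩ := hT.connected.exists_walk_length_eq_dist v z
    refine ⟨q.concat hz, SimpleGraph.Walk.isPath_of_length_eq_dist _ ?_, by simp⟩
    have := hT.dist_eq_dist_add_one_of_adj v hz
    rw [SimpleGraph.Walk.length_concat]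
    omega
  obtain ⟨p, hp, rfl⟩ := key u h hd
  obtain ⟨q, hq, rfl⟩ := key u' h' hd'
  rw [(hT.existsUnique_path v w).unique hp hq]

theorem SimpleGraph.Connected.exists_adj_dist_lt {V : Type*} {T : SimpleGraph V}
    (hT : T.Connected) {v w : V} (h : w ≠ v) : ∃ u, T.Adj u w ∧ T.dist v u < T.dist v w := by
  obtain ⟨p, hp⟩ := hT.exists_walk_length_eq_dist w v
  cases p with
  | nil => exact absurd rfl h
  | @cons _ u _ hu q =>
    refine ⟨u, hu.symm, ?_⟩
    have := T.dist_le q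
    rw [SimpleGraph.Walk.length_cons] at hp
    rw [T.dist_comm (u := v), T.dist_comm (u := v)]
    omega

open Classical in
/-- A tree maps locally injectively to a graph, into a set in which every vertex has enough
neighbours. -/
theorem SimpleGraph.IsTree.exists_locally_injective_hom {V W : Type*} [Fintype V] [Fintype W]
    {T : SimpleGraph V} (hT : T.IsTree) (K : SimpleGraph W) (S : Finset W) (v : V) {x₀ : W}
    (hx₀ : x₀ ∈ S) (hv : T.degree v ≤ (S.filter (K.Adj x₀)).card)
    (hdeg : ∀ w, w ≠ v → ∀ x ∈ S, T.degree w ≤ (S.filter (K.Adj x)).card) :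
    ∃ f : T →g K, ∀ a b c, T.Adj a b → T.Adj b c → a ≠ c → f a ≠ f c := by
  -- Vertices are added in order of distance from `v`, so each new one has exactly one neighbour
  -- already mapped.
  have key : ∀ j, j < Fintype.card V → ∃ (A : Finset V) (f : V → W), A.card = j + 1 ∧ v ∈ A ∧
      (∀ w ∈ A, ∀ u, T.dist v u < T.dist v w → u ∈ A) ∧ (∀ w ∈ A, f w ∈ S) ∧ f v = x₀ ∧
      (∀ a ∈ A, ∀ b ∈ A, T.Adj a b → K.Adj (f a) (f b)) ∧
      ∀ a ∈ A, ∀ b ∈ A, ∀ c ∈ A, T.Adj a b → T.Adj b c → a ≠ c → f a ≠ f c := by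
    intro j
    induction j with
    | zero =>
      refine fun _ => ⟨{v}, fun _ => x₀, ?_⟩
      simp_all
    | succ j ih =>
      intro hj
      obtain ⟨A, f, hcard, hvA, hdown, hS, hfv, hadj, hloc⟩ := ih (by omega)
      have hne : (Finset.univ \ A).Nonempty := by
        rw [← Finset.card_pos, Finset.card_sdiff_of_subset (Finset.subset_univ _),
          Finset.card_univ]
        omega
      obtain ⟨w, hw, hmin⟩ := Finset.exists_min_image _ (T.dist v) hne
      replace hw : w ∉ A := by simpa using hw
      replace hmin : ∀ z, T.dist v z < T.dist v w → z ∈ A := fun z hz => by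
        by_contra hzA
        exact absurd (hmin z (by simpa using hzA)) (by omega)
      obtain ⟨u, huw, hu⟩ := hT.connected.exists_adj_dist_lt (v := v) (w := w)
        (fun h => hw (h ▸ hvA))
      have huA := hmin u hu
      have huniq : ∀ z ∈ A, T.Adj z w → z = u := by
        intro z hz hzw
        refine hT.eq_of_adj_of_dist_lt (v := v) hzw huw ?_ hu
        rcases hT.dist_eq_dist_add_one_of_adj v hzw with h | h
        · exact absurd (hdown z hz w (by omega)) hw
        · omega
      -- As `w` is not yet mapped, fewer than `T.degree u` images are taken around `f u`, so some
      -- neighbour in `S` is free.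
      have hlt : ((A.filter (T.Adj u)).image f).card < (S.filter (K.Adj (f u))).card := by
        have h₁ : (A.filter (T.Adj u)).card < T.degree u := by
          rw [← T.card_neighborFinset_eq_degree]
          refine Finset.card_lt_card (Finset.ssubset_iff.2 ⟨w, by simp [hw], ?_⟩)
          intro z hz
          simp only [Finset.mem_insert, Finset.mem_filter] at hz
          rcases hz with rfl | hz
          · simpa using huw
          · simpa using hz.2
        refine (Finset.card_image_le.trans_lt h₁).trans_le ?_
        by_cases h : u = v
        · rw [h, hfv]; exact hv
        · exact hdeg u h _ (hS u huA)
      obtain ⟨y, hy, hy'⟩ := Finset.exists_mem_notMem_of_card_lt_card hlt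
      rw [Finset.mem_filter] at hy
      replace hy' : ∀ z ∈ A, T.Adj u z → f z ≠ y := fun z hz hz' h =>
        hy' (Finset.mem_image.2 ⟨z, Finset.mem_filter.2 ⟨hz, hz'⟩, h⟩)
      have hfA : ∀ z ∈ A, Function.update f w y z = f z := fun z hz =>
        Function.update_of_ne (fun h => hw (by rwa [← h])) _ _
      have hfw : Function.update f w y w = y := Function.update_self ..
      generalize Function.update f w y = g at hfA hfw
      have huniq' : ∀ z ∈ A, T.Adj w z → z = u := fun z hz h => huniq z hz h.symm
      have hirr := fun z => T.irrefl (v := z)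
      refine ⟨insert w A, g, by rw [Finset.card_insert_of_notMem hw, hcard], by simp [hvA], ?_,
        ?_, by rw [hfA v hvA, hfv], ?_, ?_⟩
      · intro z hz z' hz'
        rcases Finset.mem_insert.1 hz with rfl | hz
        · exact Finset.mem_insert_of_mem (hmin z' hz')
        · exact Finset.mem_insert_of_mem (hdown z hz z' hz')
      · intro z hz
        rcases Finset.mem_insert.1 hz with rfl | hz
        · rw [hfw]; exact hy.1
        · rw [hfA z hz]; exact hS z hz
      · intro a ha b hb hab
        rcases Finset.mem_insert.1 ha with rfl | haA <;>
          rcases Finset.mem_insert.1 hb with rfl | hbA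
        · exact absurd hab (hirr _)
        · rw [hfw, hfA b hbA, huniq' b hbA hab]; exact hy.2.symm
        · rw [hfw, hfA a haA, huniq a haA hab]; exact hy.2
        · rw [hfA a haA, hfA b hbA]; exact hadj a haA b hbA hab
      · intro a ha b hb c hc hab hbc hac
        rcases Finset.mem_insert.1 hb with rfl | hbA
        · have haA := (Finset.mem_insert.1 ha).resolve_left hab.ne
          have hcA := (Finset.mem_insert.1 hc).resolve_left hbc.ne'
          exact absurd ((huniq a haA hab).trans (huniq' c hcA hbc).symm) hac
        rcases Finset.mem_insert.1 ha with rfl | haA <;>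
          rcases Finset.mem_insert.1 hc with rfl | hcA
        · exact absurd rfl hac
        · rw [hfw, hfA c hcA]
          exact (hy' c hcA (huniq' b hbA hab ▸ hbc)).symm
        · rw [hfw, hfA a haA]
          exact hy' a haA (huniq b hbA hbc ▸ hab.symm)
        · rw [hfA a haA, hfA c hcA]; exact hloc a haA b hbA c hcA hab hbc hac
  have hpos : 0 < Fintype.card V := Fintype.card_pos_iff.2 ⟨v⟩
  obtain ⟨A, f, hcard, -, -, -, -, hadj, hloc⟩ := key (Fintype.card V - 1) (by omega)
  have hA : A = Finset.univ := (Finset.card_eq_iff_eq_univ A).1 (by omega)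
  subst hA
  exact ⟨⟨f, fun {a b} => hadj a (Finset.mem_univ _) b (Finset.mem_univ _)⟩, fun a b c =>
    hloc a (Finset.mem_univ _) b (Finset.mem_univ _) c (Finset.mem_univ _)⟩

/-- A locally injective homomorphism maps walks without backtracking to such walks. -/
theorem SimpleGraph.Walk.isChain_edges_map {V W : Type*} {T : SimpleGraph V} {K : SimpleGraph W}
    (f : T →g K) (hf : ∀ a b c, T.Adj a b → T.Adj b c → a ≠ c → f a ≠ f c) {x y : V}
    (p : T.Walk x y) (hp : p.edges.IsChain (· ≠ ·)) : (p.map f).edges.IsChain (· ≠ ·) := by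
  induction p with
  | nil => simp
  | cons h q ih =>
    rw [edges_cons, List.isChain_cons] at hp
    rw [map_cons, edges_cons, List.isChain_cons]
    refine ⟨?_, ih hp.2⟩
    cases q with
    | nil => simp
    | cons h' q =>
      simp only [edges_cons, List.head?_cons, Option.mem_some_iff, forall_eq', map_cons] at hp ⊢
      have hne := hf _ _ _ h h' (fun hac => hp.1 (by rw [hac, Sym2.eq_swap]))
      intro heq
      rcases Sym2.eq_iff.1 heq with ⟨h₁, h₂⟩ | ⟨h₁, h₂⟩
      · exact hne (h₁.trans h₂)
      · exact hne h₁

/-- A locally injective homomorphism from a tree to a graph whose short closed walks all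
backtrack is injective. -/
theorem SimpleGraph.IsTree.injective_of_locally_injective {V W : Type*} [Fintype V]
    {T : SimpleGraph V} (hT : T.IsTree) {K : SimpleGraph W} {r : ℕ} (hr : Fintype.card V ≤ r)
    (hK : ∀ x y (p : K.Walk x y), p.edges.IsChain (· ≠ ·) → p.length ≤ r → x = y → p.length = 0)
    (f : T →g K) (hf : ∀ a b c, T.Adj a b → T.Adj b c → a ≠ c → f a ≠ f c) :
    Function.Injective f := by
  intro a b hab
  obtain ⟨p, hp, -⟩ := hT.existsUnique_path a b
  have h := hK _ _ (p.map f)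
    (SimpleGraph.Walk.isChain_edges_map f hf p ((hT.isAcyclic.isPath_iff_isChain p).1 hp))
    (by rw [SimpleGraph.Walk.length_map]; exact hp.length_lt.le.trans hr) hab
  rw [SimpleGraph.Walk.length_map] at h
  exact SimpleGraph.Walk.eq_of_length_eq_zero h

/-! ### Dense colour classes and the two bounds -/

open Classical in
/-- A graph of average degree more than `q` has a nonempty set of vertices, inducing a subgraph of
minimum degree more than `q / 2` in which some vertex has degree more than `q`. -/
theorem SimpleGraph.exists_dense_finset {W : Type*} (K : SimpleGraph W) (q : ℕ) (S : Finset W)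
    (hS : q * S.card < ∑ x ∈ S, (S.filter (K.Adj x)).card) :
    ∃ S : Finset W, (∀ x ∈ S, q < 2 * (S.filter (K.Adj x)).card) ∧
      ∃ x ∈ S, q < (S.filter (K.Adj x)).card := by
  induction S using Finset.strongInduction with
  | H S ih =>
    by_cases h : ∀ x ∈ S, q < 2 * (S.filter (K.Adj x)).card
    · refine ⟨S, h, ?_⟩
      by_contra! hle
      have := Finset.sum_le_card_nsmul S _ q hle
      rw [smul_eq_mul, mul_comm] at this
      omega
    -- Deleting `x` lowers the degree sum by twice its degree, at most `q`, so the average stays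
    -- above `q`.
    · push Not at h
      obtain ⟨x, hx, hle⟩ := h
      refine ih (S.erase x) (Finset.erase_ssubset hx) ?_
      obtain ⟨R, hxR, rfl⟩ : ∃ R, x ∉ R ∧ S = insert x R :=
        ⟨S.erase x, Finset.notMem_erase x S, (Finset.insert_erase hx).symm⟩
      rw [Finset.erase_insert hxR]
      simp only [Finset.card_filter, Finset.sum_insert hxR, SimpleGraph.irrefl, if_false,
        zero_add, Finset.card_insert_of_notMem hxR, Finset.sum_add_distrib, K.adj_comm _ x]
        at hS hle ⊢
      rw [mul_add] at hS
      omega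

open Classical in
/-- Some colour class of an edge labelling has at least the average degree sum. -/
theorem SimpleGraph.EdgeLabeling.exists_lt_sum_degree {W : Type*} [Fintype W]
    {H : SimpleGraph W} {s q : ℕ} (c : H.EdgeLabeling (Fin s))
    (h : s * q < ∑ x, H.degree x) : ∃ i, q < ∑ x, (c.labelGraph i).degree x := by
  by_contra! hle
  have hdeg : ∀ x, H.degree x ≤ ∑ i, (c.labelGraph i).degree x := fun x => by
    simp only [← SimpleGraph.card_neighborFinset_eq_degree]
    refine le_trans (Finset.card_le_card fun y hy => ?_) Finset.card_biUnion_le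
    have hxy : H.Adj x y := by simpa using hy
    simp only [Finset.mem_biUnion, Finset.mem_univ, true_and, SimpleGraph.mem_neighborFinset]
    exact ⟨c ⟨s(x, y), hxy⟩, (SimpleGraph.EdgeLabeling.labelGraph_adj x y).2 ⟨hxy, rfl⟩⟩
  have h₁ := Finset.sum_le_sum fun x (_ : x ∈ Finset.univ) => hdeg x
  rw [Finset.sum_comm] at h₁
  have h₂ := Finset.sum_le_card_nsmul Finset.univ _ q fun i _ => hle i
  simp only [Finset.card_univ, Fintype.card_fin, smul_eq_mul] at h₂
  omega

open Classical in
/-- If `H` is bipartite and arrows a graph with a vertex of degree `m + 1`, then its maximum degree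
exceeds `s * m`. -/
theorem RamseyArrow.lt_maxDegree {V W : Type*} [Fintype V] [Fintype W] {H : SimpleGraph W}
    {G : SimpleGraph V} {s m : ℕ} (h : RamseyArrow H G s) (hH : H.IsBipartite) {v : V}
    (hv : m < G.degree v) : s * m < H.maxDegree := by
  by_contra! hle
  obtain ⟨c, hc⟩ := hH.exists_edgeLabeling_degree_le (s := s) (m := m)
    fun x => (H.degree_le_maxDegree x).trans hle
  obtain ⟨i, ⟨f⟩⟩ := h c
  exact absurd ((f.degree_le v).trans (hc i (f v))) (by omega)

open Classical in
/-- A tree with one vertex of degree at most `q + 1` and all others of degree at most `(q + 2) / 2`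
is arrowed by regular graphs of degree `s * q + 1` without short nonbacktracking closed walks. -/
theorem ramseyArrow_of_no_short_closed_walk {V W : Type*} [Fintype V] [Fintype W] [Nonempty W]
    {T : SimpleGraph V} (hT : T.IsTree) {H : SimpleGraph W} {q s r : ℕ}
    (hdH : ∀ x, H.degree x = s * q + 1) (hr : Fintype.card V ≤ r)
    (hH : ∀ x y (p : H.Walk x y), p.edges.IsChain (· ≠ ·) → p.length ≤ r → x = y → p.length = 0)
    {v : V} (hv : T.degree v ≤ q + 1) (hdeg : ∀ w, w ≠ v → 2 * T.degree w ≤ q + 2) :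
    RamseyArrow H T s := by
  intro c
  obtain ⟨i, hi⟩ := c.exists_lt_sum_degree (q := q * Fintype.card W) (by
    simp only [hdH, Finset.sum_const, Finset.card_univ, smul_eq_mul]
    have : 0 < Fintype.card W := Fintype.card_pos
    nlinarith)
  obtain ⟨S, hmin, x₀, hx₀, hmax⟩ := (c.labelGraph i).exists_dense_finset q Finset.univ (by
    simp only [← SimpleGraph.card_neighborFinset_eq_degree,
      SimpleGraph.neighborFinset_eq_filter] at hi
    convert hi
    exact Finset.card_univ)
  -- Integrality matters: `2 * a ≤ q + 2` and `q < 2 * b` give `a ≤ b` for either parity of `q`.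
  obtain ⟨f, hf⟩ := hT.exists_locally_injective_hom (c.labelGraph i) S v hx₀ (by omega)
    fun w hw x hx => by
      have := hmin x hx
      have := hdeg w hw
      omega
  exact ⟨i, ⟨⟨f, hT.injective_of_locally_injective hr hH
    ((SimpleGraph.Hom.ofLE c.labelGraph_le).comp f) hf⟩⟩⟩

theorem theorem1 {V : Type*} [Fintype V] (T : SimpleGraph V) [DecidableRel T.Adj]
    (hT : T.IsTree) (k s : ℕ) (hk : 1 ≤ k) (hs : 1 ≤ s) (v : V) (hv : T.degree v = k)
    (hdeg : ∀ w : V, w ≠ v → T.degree w ≤ ⌈(k : ℚ) / 2⌉₊) :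
    (bipartiteRamseyDegrees T s).Nonempty ∧
      degreeBipartiteRamsey T s = s * (k - 1) + 1 := by
  classical
  have hdeg' : ∀ w, w ≠ v → 2 * T.degree w ≤ k - 1 + 2 := fun w hw => by
    have h₁ : ⌈(k : ℚ) / 2⌉₊ ≤ (k + 1) / 2 := by
      rw [Nat.ceil_le, div_le_iff₀ two_pos]
      have : k ≤ (k + 1) / 2 * 2 := by omega
      exact_mod_cast this
    have := hdeg w hw
    omega
  have hmem : s * (k - 1) + 1 ∈ bipartiteRamseyDegrees T s := by
    -- The `+ 2` only secures the requirement `2 ≤ r`.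
    obtain ⟨n, H, hn, hbip, hreg, hwalk⟩ := exists_regular_bipartite_no_short_closed_walk
      (s * (k - 1) + 1) (r := Fintype.card V + 2) (by omega)
    have : Nonempty (Fin n) := ⟨⟨0, hn⟩⟩
    refine ⟨n, H, hbip, ramseyArrow_of_no_short_closed_walk hT hreg (by omega) hwalk
      (v := v) ?_ ?_, SimpleGraph.IsRegularOfDegree.maxDegree_eq H hreg⟩
    · convert (show T.degree v ≤ k - 1 + 1 by omega)
    · intro w hw
      convert hdeg' w hw
  refine ⟨⟨_, hmem⟩, le_antisymm (Nat.sInf_le hmem) (le_csInf ⟨_, hmem⟩ ?_)⟩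
  rintro d ⟨n, H, hbip, harrow, rfl⟩
  refine harrow.lt_maxDegree hbip (v := v) ?_
  have : k - 1 < T.degree v := by omega
  convert this
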